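/- Let $d\ge 0$ be an integer, let $p\in[1,\infty)$, and let $\mathcal P(\mathbb R^d)$ be the set of Borel probability measures on $\mathbb R^d$ and $\mathcal P_p(\mathbb R^d)$ the subset of those with finite moment of order $p$. For $P,Q\in\mathcal P_p(\mathbb R^d)$ let $$W_p(P,Q)=\Bigl(\inf_{\gamma}\int \|x-y\|^p\,d\gamma(x,y)\Bigr)^{1/p}$$ be the $p$-Wasserstein distance, the infimum being over all couplings $\gamma$ of $P$ and $Q$ and $\|\cdot\|$ being the Euclidean norm. For $P\in\mathcal P(\mathbb R^d)$, let $P^n$ denote the law of an i.i.d. sample $\mathbf X_n=(X_1,\dots,X_n)$ from $P$, and let $\widehat P_n=n^{-1}\sum_{i=1}^n\delta_{X_i}$ be its empirical distribution. Let $(\Theta,\rho)$ be a metric space, let $\mathcal M=\{P_\theta:\theta\in\Theta\}\subseteq\mathcal P_p(\mathbb R^d)$, and let $\hat\theta_n=\theta_n(\mathbf X_n)\in\Theta$, $n\ge 1$, be an estimator sequence, each $\theta_n$ being a Borel measurable function on $(\mathbb R^d)^n$. Put $$T_n=W_p^p(\widehat P_n,P_{\hat\theta_n}),\qquad F_{n,\theta}(t)=P_\theta^n[T_n\le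 t],\qquad c(\alpha,n,\theta)=\inf\{t\ge 0: F_{n,\theta}(t)\ge 1-\alpha\},$$ and let the parametric-bootstrap test be $\phi^n_\alpha=1$ if $1-F_{n,\hat\theta_n}(T_n)\le\alpha$ or, equivalently, $T_n\ge c(\alpha,n,\hat\theta_n)$, and $\phi^n_\alpha=0$ otherwise. Assume: (a) the map $\theta\mapsto P_\theta$ is one-to-one and continuous from $(\Theta,\rho)$ to $(\mathcal P_p(\mathbb R^d),W_p)$; (b) $\hat\theta_n$ is weakly consistent locally uniformly in $\theta$: for every $\varepsilon>0$ and every compact $K\subseteq\Theta$, $\lim_{n\to\infty}\sup_{\theta\in K}P_\theta^n[\rho(\hat\theta_n,\theta)>\varepsilon]=0$. Then: (i) for every $\varepsilon>0$ and every compact $K\subseteq\Theta$, $\lim_{n\to\infty}\sup_{\theta\in K}P_\theta^n[T_n>\varepsilon]=0$; (ii) for every $\alpha>0$ and every compact $K\subseteq\Theta$, $\lim_{n\to\infty}\sup_{\theta\in K}c(\alpha,n,\theta)=0$; (iii) for every $\alpha>0$ and every $P\in\mathcal P(\mathbb R^d)\setminus\mathcal M$ for which there is a compact $K\subseteq\Theta$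 with $P^n[\hat\theta_n\in K]\to1$ as $n\to\infty$, we have $\lim_{n\to\infty}P^n[\phi^n_\alpha=1]=1$. -/

import Mathlib

open MeasureTheory Filter Topology
open scoped ENNReal

noncomputable section

namespace WassersteinGoF

/-- `ℝ^d` with its Euclidean norm. -/
abbrev E (d : ℕ) : Type := EuclideanSpace ℝ (Fin d)

/-- The couplings of `μ` and `ν`: measures on the product with marginals `μ` and `ν`. -/
def couplings {d : ℕ} (μ ν : Measure (E d)) : Set (Measure (E d × E d)) :=
  {γ | γ.map Prod.fst = μ ∧ γ.map Prod.snd = ν}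

/-- The `p`-Wasserstein distance, as an extended nonnegative real. It is finite when `μ` and `ν`
are probability measures with finite moments of order `p`. -/
def wasserstein {d : ℕ} (p : ℝ) (μ ν : Measure (E d)) : ℝ≥0∞ :=
  (⨅ γ ∈ couplings μ ν, ∫⁻ z, ‖z.1 - z.2‖ₑ ^ p ∂γ) ^ (1 / p)

/-- Finite moment of order `p`. -/
def HasFiniteMoment {d : ℕ} (p : ℝ) (μ : Measure (E d)) : Prop :=
  ∫⁻ x, ‖x‖ₑ ^ p ∂μ < ∞

/-- The empirical distribution of the sample `x 0, …, x (n - 1)`. -/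
def empirical {d n : ℕ} (x : Fin n → E d) : Measure (E d) :=
  (n : ℝ≥0∞)⁻¹ • ∑ i, Measure.dirac (x i)

/-- The law of an i.i.d. sample of size `n` from `μ`. -/
def sampleLaw {d : ℕ} (μ : ProbabilityMeasure (E d)) (n : ℕ) : Measure (Fin n → E d) :=
  Measure.pi fun _ => (μ : Measure (E d))

/-- Continuity of `θ ↦ P θ` for the metric `W_p`. -/
def WassersteinContinuous {d : ℕ} {Θ : Type*} [TopologicalSpace Θ] (p : ℝ)
    (P : Θ → ProbabilityMeasure (E d)) : Prop :=
  ∀ θ₀, Tendsto (fun θ => wasserstein p (P θ : Measure (E d)) (P θ₀)) (𝓝 θ₀) (𝓝 0)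

variable {d : ℕ} {Θ : Type*}

/-- The test statistic: the `p`-th power of the `p`-Wasserstein distance between the empirical
distribution and the model distribution at the estimated parameter. -/
def testStat (p : ℝ) (P : Θ → ProbabilityMeasure (E d)) (est : (n : ℕ) → (Fin n → E d) → Θ)
    (n : ℕ) (x : Fin n → E d) : ℝ :=
  (wasserstein p (empirical x) (P (est n x))).toReal ^ p

/-- The distribution function `t ↦ P_θ^n[T_n ≤ t]` of the test statistic at the parameter `θ`. -/
def nullCDF (p : ℝ) (P : Θ → ProbabilityMeasure (E d)) (est : (n : ℕ) → (Fin n → E d) → Θ)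
    (n : ℕ) (θ : Θ) (t : ℝ) : ℝ :=
  (sampleLaw (P θ) n).real {x | testStat p P est n x ≤ t}

/-- The critical value at the parameter `θ`. -/
def critValue (p : ℝ) (P : Θ → ProbabilityMeasure (E d)) (est : (n : ℕ) → (Fin n → E d) → Θ)
    (α : ℝ) (n : ℕ) (θ : Θ) : ℝ :=
  sInf {t : ℝ | 0 ≤ t ∧ 1 - α ≤ nullCDF p P est n θ t}

open Classical in
/-- The parametric bootstrap test: it rejects (value `1`) when the `p`-value of the test statistic,
computed at the estimated parameter, is at most `α`. -/
def bootTest (p : ℝ) (P : Θ → ProbabilityMeasure (E d)) (est : (n : ℕ) → (Fin n → E d) → Θ)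
    (α : ℝ) (n : ℕ) (x : Fin n → E d) : ℕ :=
  if 1 - nullCDF p P est n (est n x) (testStat p P est n x) ≤ α then 1 else 0

/-- Weak consistency of the estimator sequence, locally uniformly in the parameter. -/
def LocUnifConsistent [MetricSpace Θ] (P : Θ → ProbabilityMeasure (E d))
    (est : (n : ℕ) → (Fin n → E d) → Θ) : Prop :=
  ∀ ε : ℝ, 0 < ε → ∀ K : Set Θ, IsCompact K →
    Tendsto (fun n => ⨆ θ ∈ K, sampleLaw (P θ) n {x | ε < dist (est n x) θ}) atTop (𝓝 0)

end WassersteinGoF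

end

/-! Everything rests on a law of large numbers for `W_p(P̂_n, P_θ)` that is uniform over compact
sets of parameters (`tendsto_iSup_sampleLaw_wasserstein`). Near `θ₀`, all `P_θ` are close to one
finitely supported law `R`. For `R`, the weights of the finitely many atoms converge by Chebyshev,
and only the missing mass has to be moved. A product of `n` copies of a coupling of `P_θ` and `R`,
with Markov's inequality, carries the bound from `R` to every nearby `θ` at the same `n`
(`sampleLaw_wasserstein_le`).

Then (i) is the triangle inequality through `P_θ`: consistency and a Lebesgue number control the
distance from `P_θ` to the fitted law. A uniformly small tail bounds the critical values, which is
(ii). For (iii), bounded Lipschitz functions keep the empirical law of `Q` away from the models in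
`K`, without any moment of `Q` (`exists_tendsto_sampleLaw_wasserstein_lt`). So `T_n` stays above a
fixed level, while the tail bound, uniform over `K`, also holds at the random parameter `est n x`.
-/

namespace WassersteinGoF

open ProbabilityTheory

/-! ### Couplings and the Wasserstein distance -/

section Wasserstein

variable {d : ℕ} {p : ℝ} {μ ν ξ : Measure (E d)}

lemma measurable_cost (p : ℝ) : Measurable fun z : E d × E d => ‖z.1 - z.2‖ₑ ^ p := by
  fun_prop

lemma wasserstein_le_of_mem_couplings (hp : 0 < p) {γ : Measure (E d × E d)}
    (hγ : γ ∈ couplings μ ν) :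
    wasserstein p μ ν ≤ (∫⁻ z, ‖z.1 - z.2‖ₑ ^ p ∂γ) ^ (1 / p) :=
  ENNReal.rpow_le_rpow (iInf₂_le γ hγ) (by positivity)

lemma exists_mem_couplings_of_wasserstein_lt (hp : 0 < p) {δ : ℝ≥0∞}
    (h : wasserstein p μ ν < δ) :
    ∃ γ ∈ couplings μ ν, (∫⁻ z, ‖z.1 - z.2‖ₑ ^ p ∂γ) < δ ^ p := by
  have h' : (⨅ γ ∈ couplings μ ν, ∫⁻ z, ‖z.1 - z.2‖ₑ ^ p ∂γ) < δ ^ p := by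
    rw [wasserstein, one_div] at h
    exact (ENNReal.rpow_inv_lt_iff hp).1 h
  simpa only [iInf_lt_iff, exists_prop] using h'

lemma isProbabilityMeasure_of_mem_couplings [IsProbabilityMeasure μ] {γ : Measure (E d × E d)}
    (hγ : γ ∈ couplings μ ν) : IsProbabilityMeasure γ := by
  constructor
  have h : γ.map Prod.fst Set.univ = 1 := by rw [hγ.1]; exact measure_univ
  rwa [Measure.map_apply measurable_fst MeasurableSet.univ, Set.preimage_univ] at h

lemma swap_mem_couplings {γ : Measure (E d × E d)} (hγ : γ ∈ couplings μ ν) :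
    γ.map Prod.swap ∈ couplings ν μ := by
  constructor
  · rw [Measure.map_map measurable_fst measurable_swap]; exact hγ.2
  · rw [Measure.map_map measurable_snd measurable_swap]; exact hγ.1

lemma lintegral_cost_swap (p : ℝ) (γ : Measure (E d × E d)) :
    ∫⁻ z, ‖z.1 - z.2‖ₑ ^ p ∂(γ.map Prod.swap) = ∫⁻ z, ‖z.1 - z.2‖ₑ ^ p ∂γ := by
  rw [lintegral_map (measurable_cost p) measurable_swap]
  refine lintegral_congr fun z => ?_
  rw [Prod.fst_swap, Prod.snd_swap, ← enorm_neg, neg_sub]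

lemma wasserstein_comm (p : ℝ) (μ ν : Measure (E d)) :
    wasserstein p μ ν = wasserstein p ν μ := by
  have key : ∀ μ ν : Measure (E d), (⨅ γ ∈ couplings μ ν, ∫⁻ z, ‖z.1 - z.2‖ₑ ^ p ∂γ)
      ≤ ⨅ γ ∈ couplings ν μ, ∫⁻ z, ‖z.1 - z.2‖ₑ ^ p ∂γ := fun μ ν =>
    le_iInf₂ fun γ hγ => (iInf₂_le _ (swap_mem_couplings hγ)).trans (lintegral_cost_swap p γ).le
  rw [wasserstein, wasserstein, le_antisymm (key μ ν) (key ν μ)]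

/-- Gluing of two couplings along their common marginal. -/
lemma exists_gluing [IsProbabilityMeasure μ] [IsProbabilityMeasure ν]
    {γ₁ γ₂ : Measure (E d × E d)} (h₁ : γ₁ ∈ couplings μ ν) (h₂ : γ₂ ∈ couplings ν ξ) :
    ∃ π : Measure (E d × E d × E d), π.map (fun w => (w.2.1, w.1)) = γ₁ ∧
      π.map (fun w => (w.1, w.2.2)) = γ₂ := by
  have := isProbabilityMeasure_of_mem_couplings h₁
  have := isProbabilityMeasure_of_mem_couplings h₂
  have : IsProbabilityMeasure (γ₁.map Prod.swap) :=
    Measure.isProbabilityMeasure_map measurable_swap.aemeasurable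
  have e₁ := (γ₁.map Prod.swap).disintegrate (γ₁.map Prod.swap).condKernel
  have e₂ := γ₂.disintegrate γ₂.condKernel
  have f₁ : (γ₁.map Prod.swap).fst = ν := (swap_mem_couplings h₁).1
  have f₂ : γ₂.fst = ν := h₂.1
  rw [f₁] at e₁
  rw [f₂] at e₂
  set κ₁ := (γ₁.map Prod.swap).condKernel
  set κ₂ := γ₂.condKernel
  -- Draw the middle point from `ν`, then the two outer points conditionally independently; the
  -- coordinates are ordered (middle, left, right).
  refine ⟨ν ⊗ₘ (κ₁ ×ₖ κ₂), ?_, ?_⟩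
  · have : γ₁ = (ν ⊗ₘ κ₁).map Prod.swap := by
      rw [e₁, Measure.map_map measurable_swap measurable_swap]; simp
    rw [this]
    ext s hs
    have hm : Measurable fun w : E d × E d × E d => (w.2.1, w.1) := by fun_prop
    rw [Measure.map_apply hm hs, Measure.map_apply measurable_swap hs,
      Measure.compProd_apply (hm hs), Measure.compProd_apply (measurable_swap hs)]
    refine lintegral_congr fun y => ?_
    conv_rhs => rw [← Kernel.fst_prod κ₁ κ₂]
    rw [Kernel.fst_apply' _ _ (measurable_prodMk_left (measurable_swap hs))]
    rfl
  · rw [← e₂]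
    ext s hs
    have hm : Measurable fun w : E d × E d × E d => (w.1, w.2.2) := by fun_prop
    rw [Measure.map_apply hm hs, Measure.compProd_apply (hm hs), Measure.compProd_apply hs]
    refine lintegral_congr fun y => ?_
    conv_rhs => rw [← Kernel.snd_prod κ₁ κ₂]
    rw [Kernel.snd_apply' _ _ (measurable_prodMk_left hs)]
    rfl

lemma wasserstein_triangle (hp : 1 ≤ p) [IsProbabilityMeasure μ] [IsProbabilityMeasure ν]
    (ξ : Measure (E d)) :
    wasserstein p μ ξ ≤ wasserstein p μ ν + wasserstein p ν ξ := by
  have hp0 : 0 < p := by linarith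
  refine le_of_forall_gt_imp_ge_of_dense fun c hc => ?_
  obtain ⟨a, b, ha, hb, hab⟩ : ∃ a b, wasserstein p μ ν < a ∧ wasserstein p ν ξ < b ∧ a + b ≤ c := by
    have h1 : wasserstein p μ ν ≠ ∞ := (lt_of_le_of_lt le_self_add hc).ne_top
    have h2 : wasserstein p ν ξ ≠ ∞ := (lt_of_le_of_lt le_add_self hc).ne_top
    obtain ⟨r, hr0, hr⟩ := ENNReal.lt_iff_exists_add_pos_lt.1 hc
    have hr2 : (r / 2 : ℝ≥0∞) ≠ 0 := by simpa using hr0.ne'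
    refine ⟨wasserstein p μ ν + r / 2, wasserstein p ν ξ + r / 2, ENNReal.lt_add_right h1 hr2,
      ENNReal.lt_add_right h2 hr2, ?_⟩
    calc _ = wasserstein p μ ν + wasserstein p ν ξ + (r / 2 + r / 2 : ℝ≥0∞) := by ring
      _ ≤ c := by rw [ENNReal.add_halves]; exact hr.le
  obtain ⟨γ₁, h₁, l₁⟩ := exists_mem_couplings_of_wasserstein_lt hp0 ha
  obtain ⟨γ₂, h₂, l₂⟩ := exists_mem_couplings_of_wasserstein_lt hp0 hb
  obtain ⟨π, π₁, π₂⟩ := exists_gluing h₁ h₂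
  have hπ : π.map (fun w => (w.2.1, w.2.2)) ∈ couplings μ ξ := by
    constructor
    · rw [← h₁.1, ← π₁, Measure.map_map (by fun_prop) (by fun_prop),
        Measure.map_map (by fun_prop) (by fun_prop)]; rfl
    · rw [← h₂.2, ← π₂, Measure.map_map (by fun_prop) (by fun_prop),
        Measure.map_map (by fun_prop) (by fun_prop)]; rfl
  have i₁ : (∫⁻ w, ‖w.2.1 - w.1‖ₑ ^ p ∂π) = ∫⁻ z, ‖z.1 - z.2‖ₑ ^ p ∂γ₁ := by
    rw [← π₁, lintegral_map (measurable_cost p) (by fun_prop)]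
  have i₂ : (∫⁻ w, ‖w.1 - w.2.2‖ₑ ^ p ∂π) = ∫⁻ z, ‖z.1 - z.2‖ₑ ^ p ∂γ₂ := by
    rw [← π₂, lintegral_map (measurable_cost p) (by fun_prop)]
  have root : ∀ {u v : ℝ≥0∞}, u < v ^ p → u ^ (1 / p) ≤ v := fun {u v} h => by
    rw [one_div]; exact (ENNReal.rpow_inv_le_iff hp0).2 h.le
  calc wasserstein p μ ξ ≤ _ := wasserstein_le_of_mem_couplings hp0 hπ
    _ = (∫⁻ w, ‖w.2.1 - w.2.2‖ₑ ^ p ∂π) ^ (1 / p) := by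
        rw [lintegral_map (measurable_cost p) (by fun_prop)]
    _ ≤ (∫⁻ w, ((fun w : E d × E d × E d => ‖w.2.1 - w.1‖ₑ) +
          fun w : E d × E d × E d => ‖w.1 - w.2.2‖ₑ) w ^ p ∂π) ^ (1 / p) := by
        gcongr with w
        rw [Pi.add_apply]
        calc ‖w.2.1 - w.2.2‖ₑ = ‖(w.2.1 - w.1) + (w.1 - w.2.2)‖ₑ := by rw [sub_add_sub_cancel]
          _ ≤ _ := enorm_add_le _ _
    _ ≤ (∫⁻ w, ‖w.2.1 - w.1‖ₑ ^ p ∂π) ^ (1 / p) + (∫⁻ w, ‖w.1 - w.2.2‖ₑ ^ p ∂π) ^ (1 / p) :=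
        ENNReal.lintegral_Lp_add_le (f := fun w : E d × E d × E d => ‖w.2.1 - w.1‖ₑ)
          (g := fun w => ‖w.1 - w.2.2‖ₑ) (by fun_prop) (by fun_prop) hp
    _ ≤ a + b := by rw [i₁, i₂]; exact add_le_add (root l₁) (root l₂)
    _ ≤ c := hab

lemma isProbabilityMeasure_empirical {n : ℕ} (hn : n ≠ 0) (x : Fin n → E d) :
    IsProbabilityMeasure (empirical x) := by
  constructor
  simp [empirical, ENNReal.inv_mul_cancel, hn]

/-- Couple the `i`-th point with the `i`-th point. This gives both continuity in the sample and the
comparison of coupled samples. -/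
lemma wasserstein_empirical_le (hp : 0 < p) {n : ℕ} (x y : Fin n → E d) :
    wasserstein p (empirical x) (empirical y)
      ≤ ((n : ℝ≥0∞)⁻¹ * ∑ i, ‖x i - y i‖ₑ ^ p) ^ (1 / p) := by
  have h : (n : ℝ≥0∞)⁻¹ • ∑ i, Measure.dirac (x i, y i)
      ∈ couplings (empirical x) (empirical y) := by
    constructor <;>
    · rw [Measure.map_smul, Measure.map_finset_sum' (by fun_prop)]
      simp only [Measure.map_dirac' measurable_fst, Measure.map_dirac' measurable_snd]
      rfl
  refine (wasserstein_le_of_mem_couplings hp h).trans_eq ?_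
  rw [lintegral_smul_measure, lintegral_finsetSum_measure]
  simp_rw [lintegral_dirac' _ (measurable_cost p)]
  rfl

/-- If `μ` dominates `t • ν` and both live on `S`, then transporting only the excess mass is
enough. -/
lemma wasserstein_le_of_smul_le (hp : 0 < p) [IsProbabilityMeasure μ] [IsProbabilityMeasure ν]
    {t C : ℝ≥0∞} (ht : t ≤ 1) (hle : t • ν ≤ μ) {S : Set (E d)} (hμ : ∀ᵐ x ∂μ, x ∈ S)
    (hν : ∀ᵐ x ∂ν, x ∈ S) (hC : ∀ x ∈ S, ∀ y ∈ S, ‖x - y‖ₑ ^ p ≤ C) :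
    wasserstein p μ ν ≤ (C * (1 - t)) ^ (1 / p) := by
  have ht' : t ≠ ∞ := (ht.trans_lt ENNReal.one_lt_top).ne
  have : IsFiniteMeasure (t • ν) := ν.smul_finite ht'
  have hmass : (μ - t • ν) Set.univ = 1 - t := by
    rw [Measure.sub_apply MeasurableSet.univ hle]; simp
  have hdiag : Measurable fun x : E d => (x, x) := by fun_prop
  -- The common part `t • ν` stays in place; the excess, of mass `1 - t`, is redistributed
  -- independently according to `ν`.
  have h : t • ν.map (fun x => (x, x)) + (μ - t • ν).prod ν ∈ couplings μ ν := by
    constructor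
    · rw [Measure.map_add _ _ measurable_fst, Measure.map_smul,
        Measure.map_map measurable_fst hdiag, Measure.map_fst_prod, measure_univ, one_smul]
      change t • ν.map id + _ = _
      rw [Measure.map_id, add_comm, Measure.sub_add_cancel_of_le hle]
    · rw [Measure.map_add _ _ measurable_snd, Measure.map_smul,
        Measure.map_map measurable_snd hdiag, Measure.map_snd_prod, hmass]
      change t • ν.map id + _ = _
      rw [Measure.map_id, ← add_smul, add_tsub_cancel_of_le ht, one_smul]
  refine (wasserstein_le_of_mem_couplings hp h).trans
    (ENNReal.rpow_le_rpow ?_ (by positivity))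
  rw [lintegral_add_measure, lintegral_smul_measure, lintegral_map (measurable_cost p) hdiag]
  have hz : ∀ x : E d, ‖x - x‖ₑ ^ p = 0 := fun x => by simp [hp]
  simp only [hz, lintegral_zero, smul_zero, zero_add]
  have hμ' : ∀ᵐ x ∂(μ - t • ν), x ∈ S := ae_mono Measure.sub_le hμ
  rw [lintegral_prod _ (measurable_cost p).aemeasurable]
  calc ∫⁻ x, ∫⁻ y, ‖x - y‖ₑ ^ p ∂ν ∂(μ - t • ν) ≤ ∫⁻ _, C ∂(μ - t • ν) := by
        refine lintegral_mono_ae (hμ'.mono fun x hx => ?_)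
        calc ∫⁻ y, ‖x - y‖ₑ ^ p ∂ν ≤ ∫⁻ _, C ∂ν :=
              lintegral_mono_ae (hν.mono fun y hy => hC x hx y hy)
          _ = C := by simp
    _ = C * (1 - t) := by rw [lintegral_const, hmass]

lemma memLp_id_of_hasFiniteMoment (hp : 0 < p) (h : HasFiniteMoment p μ) :
    MemLp id (ENNReal.ofReal p) μ := by
  refine ⟨aestronglyMeasurable_id, ?_⟩
  rw [eLpNorm_lt_top_iff_lintegral_rpow_enorm_lt_top (by simpa using hp) ENNReal.ofReal_ne_top,
    ENNReal.toReal_ofReal hp.le]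
  exact h

lemma wasserstein_map_le (hp : 0 < p) {g : E d → E d} (hg : Measurable g) :
    wasserstein p μ (μ.map g) ≤ eLpNorm (id - g) (ENNReal.ofReal p) μ := by
  have hm : Measurable fun x => (x, g x) := by fun_prop
  have h : μ.map (fun x => (x, g x)) ∈ couplings μ (μ.map g) := by
    constructor
    · rw [Measure.map_map measurable_fst hm]; exact Measure.map_id
    · rw [Measure.map_map measurable_snd hm]; rfl
  refine (wasserstein_le_of_mem_couplings hp h).trans_eq ?_
  rw [eLpNorm_eq_lintegral_rpow_enorm_toReal (by simpa using hp) ENNReal.ofReal_ne_top,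
    ENNReal.toReal_ofReal hp.le, lintegral_map (measurable_cost p) hm]
  rfl

/-- Measures with a finite moment are approximated by finitely supported ones. -/
lemma exists_finite_support_wasserstein_lt (hp : 0 < p) (P : ProbabilityMeasure (E d))
    (h : HasFiniteMoment p (P : Measure (E d))) {δ : ℝ≥0∞} (hδ : δ ≠ 0) :
    ∃ (R : ProbabilityMeasure (E d)) (S : Finset (E d)), (∀ᵐ x ∂(R : Measure (E d)), x ∈ S) ∧
      wasserstein p (P : Measure (E d)) R < δ := by
  -- A simple function close to the identity in `L^p` pushes `P` forward to a finitely supported law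
  -- at small cost.
  obtain ⟨g, hg, -⟩ := (memLp_id_of_hasFiniteMoment hp h).exists_simpleFunc_eLpNorm_sub_lt
    ENNReal.ofReal_ne_top hδ
  refine ⟨P.map g.measurable.aemeasurable, g.range, ?_, ?_⟩
  · rw [ProbabilityMeasure.toMeasure_map]
    refine (ae_map_iff g.measurable.aemeasurable g.range.finite_toSet.measurableSet).2 ?_
    exact Eventually.of_forall fun x => SimpleFunc.mem_range_self g x
  · rw [ProbabilityMeasure.toMeasure_map]
    exact (wasserstein_map_le hp g.measurable).trans_lt hg

/-- Compare both measures with the Dirac mass at `0`. Finiteness matters because `testStat` uses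
`toReal`, which would turn an infinite distance into `0`. -/
lemma wasserstein_ne_top (hp : 1 ≤ p) [IsProbabilityMeasure μ] [IsProbabilityMeasure ν]
    (hμ : HasFiniteMoment p μ) (hν : HasFiniteMoment p ν) : wasserstein p μ ν ≠ ∞ := by
  have hp0 : 0 < p := by linarith
  have key : ∀ ν : Measure (E d), [IsProbabilityMeasure ν] → HasFiniteMoment p ν →
      wasserstein p ν (Measure.dirac 0) ≠ ∞ := by
    intro ν _ hν
    have h := wasserstein_map_le (μ := ν) hp0 (measurable_const (a := (0 : E d)))
    rw [Measure.map_const, measure_univ, one_smul] at h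
    refine (h.trans_lt ?_).ne
    have e : (id - fun _ : E d => (0 : E d)) = id := by ext x; simp
    rw [e]
    exact (memLp_id_of_hasFiniteMoment hp0 hν).eLpNorm_lt_top
  refine ((wasserstein_triangle hp (ν := Measure.dirac 0) ν).trans_lt ?_).ne
  rw [wasserstein_comm p (Measure.dirac 0) ν]
  exact ENNReal.add_lt_top.2 ⟨(key μ hμ).lt_top, (key ν hν).lt_top⟩

lemma hasFiniteMoment_empirical (hp : 0 < p) {n : ℕ} (hn : n ≠ 0) (x : Fin n → E d) :
    HasFiniteMoment p (empirical x) := by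
  rw [HasFiniteMoment, empirical, lintegral_smul_measure, lintegral_finsetSum_measure]
  simp_rw [lintegral_dirac]
  refine ENNReal.mul_lt_top (by simp [hn, pos_iff_ne_zero]) (ENNReal.sum_lt_top.2 fun i _ => ?_)
  exact ENNReal.rpow_lt_top_of_nonneg hp.le enorm_ne_top

/-- The difference of the integrals of an integrable Lipschitz function is controlled by the
Wasserstein distance. -/
lemma abs_integral_sub_le_of_wasserstein_lt (hp : 1 ≤ p) [IsProbabilityMeasure μ]
    {f : E d → ℝ} {L : NNReal} (hL : LipschitzWith L f) (hfμ : Integrable f μ)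
    (hfν : Integrable f ν) {δ : ℝ} (hδ : wasserstein p μ ν < ENNReal.ofReal δ) :
    |∫ x, f x ∂μ - ∫ x, f x ∂ν| ≤ L * δ := by
  have hp0 : 0 < p := by linarith
  have hδ0 : 0 ≤ δ := (ENNReal.ofReal_pos.1 ((zero_le).trans_lt hδ)).le
  obtain ⟨γ, hγ, hlt⟩ := exists_mem_couplings_of_wasserstein_lt hp0 hδ
  have := isProbabilityMeasure_of_mem_couplings hγ
  have hf : Continuous f := hL.continuous
  have i₁ : ∫ x, f x ∂μ = ∫ z, f z.1 ∂γ := by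
    rw [← hγ.1, integral_map (by fun_prop) (by fun_prop)]
  have i₂ : ∫ x, f x ∂ν = ∫ z, f z.2 ∂γ := by
    rw [← hγ.2, integral_map (by fun_prop) (by fun_prop)]
  have j₁ : Integrable (fun z => f z.1) γ := by
    rw [← hγ.1] at hfμ; exact hfμ.comp_measurable measurable_fst
  have j₂ : Integrable (fun z => f z.2) γ := by
    rw [← hγ.2] at hfν; exact hfν.comp_measurable measurable_snd
  -- On a probability space the `L^1` norm is at most the `L^p` norm.
  have hlp : ∫⁻ z, ‖z.1 - z.2‖ₑ ∂γ ≤ ENNReal.ofReal δ := by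
    have h := eLpNorm_le_eLpNorm_of_exponent_le (μ := γ) (p := 1) (q := ENNReal.ofReal p)
      (f := fun z : E d × E d => z.1 - z.2) (by simpa using hp) (by fun_prop)
    rw [eLpNorm_one_eq_lintegral_enorm, eLpNorm_eq_lintegral_rpow_enorm_toReal
      (by simpa using hp0) ENNReal.ofReal_ne_top, ENNReal.toReal_ofReal hp0.le] at h
    refine h.trans ?_
    rw [one_div]
    exact (ENNReal.rpow_inv_le_iff hp0).2 hlt.le
  rw [i₁, i₂, ← integral_sub j₁ j₂, ← Real.norm_eq_abs]
  refine (ENNReal.ofReal_le_ofReal_iff (by positivity)).1 ?_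
  rw [ofReal_norm]
  calc ‖∫ z, (f z.1 - f z.2) ∂γ‖ₑ ≤ ∫⁻ z, ‖f z.1 - f z.2‖ₑ ∂γ := enorm_integral_le_lintegral_enorm _
    _ ≤ ∫⁻ z, L * ‖z.1 - z.2‖ₑ ∂γ := lintegral_mono fun z => by
        simpa only [edist_eq_enorm_sub] using hL z.1 z.2
    _ = L * ∫⁻ z, ‖z.1 - z.2‖ₑ ∂γ := lintegral_const_mul _ (by fun_prop)
    _ ≤ L * ENNReal.ofReal δ := by gcongr
    _ = ENNReal.ofReal (L * δ) := by
        rw [ENNReal.ofReal_mul (by positivity), ENNReal.ofReal_coe_nnreal]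

end Wasserstein

/-! ### Laws of large numbers for the empirical measure -/

section Empirical

variable {d : ℕ} {p : ℝ}

instance isProbabilityMeasure_sampleLaw (Q : ProbabilityMeasure (E d)) (n : ℕ) :
    IsProbabilityMeasure (sampleLaw Q n) := by
  unfold sampleLaw; infer_instance

lemma integral_empirical {n : ℕ} (x : Fin n → E d) (f : E d → ℝ) :
    ∫ y, f y ∂(empirical x) = (n : ℝ)⁻¹ * ∑ i, f (x i) := by
  rw [empirical, integral_smul_measure, integral_finsetSum_measure fun i _ => integrable_dirac (by simp)]
  simp [integral_dirac]

/-- Weak law of large numbers for a bounded function. -/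
lemma tendsto_sampleLaw_integral_empirical (Q : ProbabilityMeasure (E d)) {f : E d → ℝ}
    (hf : Measurable f) {C : ℝ} (hC : ∀ x, |f x| ≤ C) {ε : ℝ} (hε : 0 < ε) :
    Tendsto (fun n => sampleLaw Q n
      {x | ε ≤ |∫ y, f y ∂(empirical x) - ∫ y, f y ∂(Q : Measure (E d))|}) atTop (𝓝 0) := by
  have hL : ∀ μ : Measure (E d), [IsProbabilityMeasure μ] → MemLp f 2 μ := fun μ _ =>
    MemLp.of_bound hf.aestronglyMeasurable C (Eventually.of_forall hC)
  set V := Var[f; (Q : Measure (E d))]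
  have hlim : Tendsto (fun n : ℕ => ENNReal.ofReal (V / ε ^ 2 / n)) atTop (𝓝 0) := by
    rw [← ENNReal.ofReal_zero]
    exact ENNReal.tendsto_ofReal (tendsto_const_div_atTop_nhds_zero_nat _)
  refine tendsto_of_tendsto_of_tendsto_of_le_of_le' tendsto_const_nhds hlim
    (Eventually.of_forall fun n => zero_le) ((eventually_ne_atTop 0).mono fun n hn => ?_)
  have hn' : (0 : ℝ) < n := by positivity
  have hLi : ∀ i : Fin n, MemLp (fun x : Fin n → E d => f (x i)) 2 (sampleLaw Q n) := fun i =>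
    (hL Q).comp_measurePreserving (measurePreserving_eval (fun _ => (Q : Measure (E d))) i)
  have hvar : Var[∑ i, fun x : Fin n → E d => f (x i); sampleLaw Q n] = n * V := by
    rw [sampleLaw, variance_sum_pi fun _ => hL Q]
    simp [V]
  have hmean : ∫ x, (∑ i, fun x : Fin n → E d => f (x i)) x ∂(sampleLaw Q n)
      = n * ∫ y, f y ∂(Q : Measure (E d)) := by
    simp only [Finset.sum_apply]
    rw [integral_finsetSum _ fun i _ => (hLi i).integrable (by norm_num)]
    simp only [sampleLaw]
    simp_rw [integral_comp_eval (μ := fun _ : Fin n => (Q : Measure (E d)))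
      hf.aestronglyMeasurable]
    simp
  have hmem : MemLp (∑ i, fun x : Fin n → E d => f (x i)) 2 (sampleLaw Q n) :=
    memLp_finsetSum' _ fun i _ => hLi i
  have hcheb := meas_ge_le_variance_div_sq hmem (c := n * ε) (by positivity)
  rw [hvar, hmean] at hcheb
  have e : (n : ℝ) * V / (n * ε) ^ 2 = V / ε ^ 2 / n := by field_simp
  rw [e] at hcheb
  refine (measure_mono fun x hx => ?_).trans hcheb
  simp only [Set.mem_ofPred_eq, Finset.sum_apply, integral_empirical] at hx ⊢
  calc n * ε ≤ n * |(n : ℝ)⁻¹ * ∑ i, f (x i) - ∫ y, f y ∂(Q : Measure (E d))| := by gcongr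
    _ = _ := by
      rw [← abs_of_pos hn', ← abs_mul, abs_of_pos hn', mul_sub, mul_inv_cancel_left₀ hn'.ne']

/-- The empirical measure eventually charges each point almost as much as the sampled law. -/
lemma tendsto_sampleLaw_empirical_singleton_lt (R : ProbabilityMeasure (E d)) (s : E d)
    {t : ℝ≥0∞} (ht : t < 1) :
    Tendsto (fun n => sampleLaw R n
      {x | empirical x {s} < t * (R : Measure (E d)) {s}}) atTop (𝓝 0) := by
  rcases eq_or_ne ((R : Measure (E d)) {s}) 0 with h0 | h0
  · simp [h0]
  have hR : 0 < (R : Measure (E d)).real {s} := ENNReal.toReal_pos h0 (measure_ne_top _ _)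
  have ht' : t.toReal < 1 := by
    simpa using (ENNReal.toReal_lt_toReal ht.ne_top ENNReal.one_ne_top).2 ht
  have hms : MeasurableSet ({s} : Set (E d)) := measurableSet_singleton s
  have hf : Measurable (Set.indicator {s} (1 : E d → ℝ)) := measurable_one.indicator hms
  have hb : ∀ x, |Set.indicator {s} (1 : E d → ℝ) x| ≤ 1 := fun x => by
    by_cases hx : x ∈ ({s} : Set (E d)) <;> simp [hx]
  -- Mass below `t * R {s}` is a deviation of at least `(1 - t) * R {s}` from the mean of the
  -- indicator of `s`.
  have h := tendsto_sampleLaw_integral_empirical R hf hb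
    (ε := (1 - t.toReal) * (R : Measure (E d)).real {s}) (mul_pos (by linarith) hR)
  refine tendsto_of_tendsto_of_tendsto_of_le_of_le' tendsto_const_nhds h
    (Eventually.of_forall fun n => zero_le)
    ((eventually_ne_atTop 0).mono fun n hn => measure_mono fun x hx => ?_)
  have := isProbabilityMeasure_empirical hn x
  simp only [Set.mem_ofPred_eq, integral_indicator_one hms] at hx ⊢
  have hx' : (empirical x).real {s} < t.toReal * (R : Measure (E d)).real {s} := by
    rw [Measure.real, Measure.real, ← ENNReal.toReal_mul]
    exact (ENNReal.toReal_lt_toReal (measure_ne_top _ _)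
      (ENNReal.mul_ne_top ht.ne_top (measure_ne_top _ _))).2 hx
  rw [abs_sub_comm]
  refine le_trans ?_ (le_abs_self _)
  linarith

lemma smul_le_of_forall_singleton {μ ν : Measure (E d)} {S : Finset (E d)}
    (hν : ∀ᵐ x ∂ν, x ∈ S) {t : ℝ≥0∞} (h : ∀ s ∈ S, t * ν {s} ≤ μ {s}) : t • ν ≤ μ := by
  classical
  refine Measure.le_iff.2 fun A hA => ?_
  have e : ν A = ν ↑(S.filter (· ∈ A)) := by
    refine measure_congr (hν.mono fun x hx => ?_)
    exact propext ⟨fun hxA => by simpa using ⟨hx, hxA⟩, fun hxA => (Finset.mem_filter.1 hxA).2⟩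
  calc (t • ν) A = t * ∑ s ∈ S.filter (· ∈ A), ν {s} := by
        rw [Measure.smul_apply, smul_eq_mul, e, sum_measure_singleton]
    _ = ∑ s ∈ S.filter (· ∈ A), t * ν {s} := Finset.mul_sum _ _ _
    _ ≤ ∑ s ∈ S.filter (· ∈ A), μ {s} :=
        Finset.sum_le_sum fun s hs => h s (Finset.mem_filter.1 hs).1
    _ = μ ↑(S.filter (· ∈ A)) := sum_measure_singleton
    _ ≤ μ A := measure_mono fun x hx => by simpa using (Finset.mem_filter.1 hx).2

/-- The empirical measure of a finitely supported law converges in Wasserstein distance. -/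
lemma tendsto_sampleLaw_wasserstein_of_finite_support (hp : 0 < p) (R : ProbabilityMeasure (E d))
    {S : Finset (E d)} (hS : ∀ᵐ x ∂(R : Measure (E d)), x ∈ S) {ε : ℝ≥0∞} (hε : ε ≠ 0) :
    Tendsto (fun n => sampleLaw R n {x | ε < wasserstein p (empirical x) R}) atTop (𝓝 0) := by
  set C : ℝ≥0∞ := ∑ x ∈ S, ∑ y ∈ S, ‖x - y‖ₑ ^ p
  have hCtop : C ≠ ∞ := (ENNReal.sum_lt_top.2 fun x _ => ENNReal.sum_lt_top.2 fun y _ =>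
    ENNReal.rpow_lt_top_of_nonneg hp.le enorm_ne_top).ne
  have hC : ∀ x ∈ S, ∀ y ∈ S, ‖x - y‖ₑ ^ p ≤ C := fun x hx y hy =>
    (Finset.single_le_sum (f := fun y => ‖x - y‖ₑ ^ p) (fun _ _ => zero_le) hy).trans
      (Finset.single_le_sum (f := fun x => ∑ y ∈ S, ‖x - y‖ₑ ^ p) (fun _ _ => zero_le) hx)
  -- `C` bounds every transport cost within `S`, so moving mass at most `η` costs less than `ε ^ p`.
  obtain ⟨η, hη0, hη⟩ := ENNReal.exists_nnreal_pos_mul_lt hCtop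
    (b := ε ^ p) (by simp [hε, hp, hp.le])
  set t : ℝ≥0∞ := 1 - η
  have ht : t < 1 := ENNReal.sub_lt_self ENNReal.one_ne_top one_ne_zero (by simpa using hη0.ne')
  have ht2 : 1 - t ≤ η := by
    rw [tsub_le_iff_right]; exact le_add_tsub
  have hlim : Tendsto (fun n => ∑ s ∈ S, sampleLaw R n
      {x | empirical x {s} < t * (R : Measure (E d)) {s}}) atTop (𝓝 0) := by
    rw [← Finset.sum_const_zero (s := S)]
    exact tendsto_finsetSum _ fun s _ => tendsto_sampleLaw_empirical_singleton_lt R s ht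
  refine tendsto_of_tendsto_of_tendsto_of_le_of_le' tendsto_const_nhds hlim
    (Eventually.of_forall fun n => zero_le) ((eventually_ne_atTop 0).mono fun n hn => ?_)
  refine le_trans ?_ (measure_biUnion_finset_le S _)
  have hsample : ∀ᵐ x ∂(sampleLaw R n), ∀ i, x i ∈ S := by
    refine ae_all_iff.2 fun i => ?_
    exact (measurePreserving_eval (fun _ => (R : Measure (E d))) i).quasiMeasurePreserving.ae hS
  refine measure_mono_ae (hsample.mono fun x hx hbad => ?_)
  by_contra hgood
  have := isProbabilityMeasure_empirical hn x
  have hgood' : ∀ s ∈ S, t * (R : Measure (E d)) {s} ≤ empirical x {s} := by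
    intro s hs
    by_contra hlt
    exact hgood (Set.mem_biUnion hs (not_le.1 hlt))
  have hsupp : ∀ᵐ y ∂(empirical x), y ∈ (S : Set (E d)) := by
    have hz : empirical x (S : Set (E d))ᶜ = 0 := by
      simp only [empirical, Measure.smul_apply, Measure.finsetSum_apply, smul_eq_mul]
      rw [Finset.sum_eq_zero fun i _ => ?_, mul_zero]
      rw [Measure.dirac_apply' _ S.finite_toSet.measurableSet.compl]
      simp [hx i]
    exact hz
  have hW := wasserstein_le_of_smul_le hp ht.le (smul_le_of_forall_singleton hS hgood') hsupp
    hS (C := C) (fun x hx y hy => hC x hx y hy)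
  refine absurd (hW.trans ?_) (not_le.2 hbad)
  rw [one_div]
  refine (ENNReal.rpow_inv_le_iff hp).2 ?_
  calc C * (1 - t) ≤ C * η := by gcongr
    _ ≤ ε ^ p := by rw [mul_comm]; exact hη.le

/-- A small move of the sample changes the distance little, by the triangle inequality. Openness
supplies the measurability needed to pull this event back along a projection. -/
lemma isOpen_lt_wasserstein_empirical (hp : 1 ≤ p) {n : ℕ} (hn : n ≠ 0) (μ : Measure (E d))
    (ε : ℝ≥0∞) : IsOpen {x : Fin n → E d | ε < wasserstein p (empirical x) μ} := by
  have hp0 : 0 < p := by linarith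
  rw [isOpen_iff_mem_nhds]
  intro x hx
  have hcont : Continuous fun y : Fin n → E d =>
      ε + ((n : ℝ≥0∞)⁻¹ * ∑ i, ‖x i - y i‖ₑ ^ p) ^ (1 / p) := by
    refine continuous_const.add ((ENNReal.continuous_rpow_const).comp ?_)
    refine (ENNReal.continuous_const_mul (by simp [hn])).comp ?_
    refine continuous_finsetSum _ fun i _ => (ENNReal.continuous_rpow_const).comp ?_
    fun_prop
  have hx0 : ε + ((n : ℝ≥0∞)⁻¹ * ∑ i, ‖x i - x i‖ₑ ^ p) ^ (1 / p)
      < wasserstein p (empirical x) μ := by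
    simpa [hp0] using hx
  filter_upwards [hcont.continuousAt.eventually_lt_const hx0] with y hy
  have := isProbabilityMeasure_empirical hn x
  have := isProbabilityMeasure_empirical hn y
  by_contra hle
  refine absurd hy (not_lt.2 ?_)
  calc wasserstein p (empirical x) μ
      ≤ wasserstein p (empirical x) (empirical y) + wasserstein p (empirical y) μ :=
        wasserstein_triangle hp μ
    _ ≤ _ + ε := add_le_add (wasserstein_empirical_le hp0 x y) (not_lt.1 hle)
    _ = _ := add_comm _ _

/-- Deviations of the empirical measure for `P` are controlled by those for any law close to
`P`, through a product of couplings. -/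
lemma sampleLaw_wasserstein_le (hp : 1 ≤ p) (P R : ProbabilityMeasure (E d)) {n : ℕ} (hn : n ≠ 0)
    {δ ε r : ℝ≥0∞} (hε : ε ≠ 0) (hε' : ε ≠ ∞) (h : wasserstein p (P : Measure (E d)) R < δ) :
    sampleLaw P n {x | ε + r + δ < wasserstein p (empirical x) P}
      ≤ (δ / ε) ^ p + sampleLaw R n {y | r < wasserstein p (empirical y) R} := by
  have hp0 : 0 < p := by linarith
  obtain ⟨γ, hγ, hlt⟩ := exists_mem_couplings_of_wasserstein_lt hp0 h
  have := isProbabilityMeasure_of_mem_couplings hγ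
  have hfst : (Measure.pi fun _ : Fin n => γ).map (fun z i => (z i).1) = sampleLaw P n := by
    rw [sampleLaw, ← hγ.1]
    exact Measure.pi_map_pi fun _ => measurable_fst.aemeasurable
  have hsnd : (Measure.pi fun _ : Fin n => γ).map (fun z i => (z i).2) = sampleLaw R n := by
    rw [sampleLaw, ← hγ.2]
    exact Measure.pi_map_pi fun _ => measurable_snd.aemeasurable
  rw [← hfst, Measure.map_apply (by fun_prop)
    (isOpen_lt_wasserstein_empirical hp hn _ _).measurableSet, ← hsnd]
  -- `G` bounds the `p`-th power of the distance between the two coupled empirical measures, and its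
  -- mean is the cost of `γ`.
  set G : (Fin n → E d × E d) → ℝ≥0∞ := fun z => (n : ℝ≥0∞)⁻¹ * ∑ i, ‖(z i).1 - (z i).2‖ₑ ^ p
  have hG : ∫⁻ z, G z ∂(Measure.pi fun _ : Fin n => γ) ≤ δ ^ p := by
    have hi : ∀ i : Fin n, ∫⁻ z, ‖(z i).1 - (z i).2‖ₑ ^ p ∂(Measure.pi fun _ : Fin n => γ)
        = ∫⁻ z, ‖z.1 - z.2‖ₑ ^ p ∂γ := fun i =>
      (measurePreserving_eval (fun _ : Fin n => γ) i).lintegral_comp (measurable_cost p)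
    rw [lintegral_const_mul _ (by fun_prop), lintegral_finsetSum _ fun i _ => by fun_prop]
    simp_rw [hi]
    rw [Finset.sum_const, Finset.card_univ, Fintype.card_fin, nsmul_eq_mul, ← mul_assoc,
      ENNReal.inv_mul_cancel (by simpa using hn) (by simp), one_mul]
    exact hlt.le
  have hεp : ε ^ p ≠ 0 := by simp [hε, hp0.le]
  have hmarkov : (Measure.pi fun _ : Fin n => γ) {z | ε ^ p ≤ G z} ≤ (δ / ε) ^ p := by
    refine (meas_ge_le_lintegral_div (by fun_prop) hεp
      (ENNReal.rpow_ne_top_of_nonneg hp0.le hε')).trans ?_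
    rw [ENNReal.div_rpow_of_nonneg _ _ hp0.le]
    gcongr
  -- For the second sample an inequality suffices, and it needs no measurability of the event.
  refine le_trans ?_ (add_le_add hmarkov (Measure.le_map_apply
    (Measurable.aemeasurable (by fun_prop)) _))
  refine le_trans (measure_mono fun z hz => ?_) (measure_union_le _ _)
  by_contra hcon
  simp only [Set.mem_union, Set.mem_preimage, Set.mem_ofPred_eq, not_or, not_le, not_lt]
    at hcon hz
  have := isProbabilityMeasure_empirical hn fun i => (z i).1
  have := isProbabilityMeasure_empirical hn fun i => (z i).2
  refine absurd hz (not_lt.2 ?_)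
  have h1 : wasserstein p (empirical fun i => (z i).1) (empirical fun i => (z i).2) ≤ ε := by
    refine (wasserstein_empirical_le hp0 _ _).trans ?_
    rw [one_div]
    exact (ENNReal.rpow_inv_le_iff hp0).2 hcon.1.le
  have h2 : wasserstein p (R : Measure (E d)) P ≤ δ := by rw [wasserstein_comm]; exact h.le
  calc _ ≤ wasserstein p (empirical fun i => (z i).1) (empirical fun i => (z i).2)
        + wasserstein p (empirical fun i => (z i).2) P := wasserstein_triangle hp _
    _ ≤ wasserstein p (empirical fun i => (z i).1) (empirical fun i => (z i).2)
        + (wasserstein p (empirical fun i => (z i).2) R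
        + wasserstein p (R : Measure (E d)) P) := by
          gcongr; exact wasserstein_triangle hp _
    _ ≤ ε + (r + δ) := add_le_add h1 (add_le_add hcon.2 h2)
    _ = ε + r + δ := (add_assoc _ _ _).symm

end Empirical

/-! ### Uniformity over the model and behaviour of the test -/

section Model

variable {d : ℕ} {p : ℝ} {Θ : Type*}

/-- Uniform law of large numbers in Wasserstein distance near a parameter. -/
lemma exists_nhds_sampleLaw_wasserstein_le [TopologicalSpace Θ] (hp : 1 ≤ p)
    {P : Θ → ProbabilityMeasure (E d)}
    (hmom : ∀ θ, HasFiniteMoment p (P θ : Measure (E d))) (hcont : WassersteinContinuous p P)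
    (θ₀ : Θ) {ε η : ℝ≥0∞} (hε : ε ≠ 0) (hε' : ε ≠ ∞) (hη : η ≠ 0) :
    ∃ U ∈ 𝓝 θ₀, ∀ᶠ n in atTop, ∀ θ ∈ U,
      sampleLaw (P θ) n {x | ε < wasserstein p (empirical x) (P θ)} ≤ η := by
  have hp0 : 0 < p := by linarith
  set e := ε / 3
  have he : e ≠ 0 := by simp [e, hε]
  have he' : e ≠ ∞ := ENNReal.div_ne_top hε' (by simp)
  -- With `δ = m * e`, the Markov term is `m ^ p ≤ m ≤ η / 2`, as `m ≤ 1 ≤ p`.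
  set m := min (η / 2) 1
  have hm : m ≠ 0 := by simp [m, min_eq_iff, hη]
  have hm1 : m ≤ 1 := min_le_right _ _
  set δ := m * e
  have hδ : δ / 2 ≠ 0 := by simp [δ, hm, he]
  have hδe : δ ≤ e := mul_le_of_le_one_left zero_le hm1
  have hδm : (δ / e) ^ p ≤ η / 2 := by
    rw [ENNReal.mul_div_cancel_right he he']
    calc m ^ p ≤ m ^ (1 : ℝ) := ENNReal.rpow_le_rpow_of_exponent_ge hm1 hp
      _ ≤ η / 2 := by rw [ENNReal.rpow_one]; exact min_le_left _ _
  -- `R` depends on `θ₀` only, so one threshold for `n` serves the whole neighbourhood.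
  obtain ⟨R, S, hS, hR⟩ := exists_finite_support_wasserstein_lt hp0 (P θ₀) (hmom θ₀) hδ
  refine ⟨{θ | wasserstein p (P θ : Measure (E d)) (P θ₀) < δ / 2},
    (hcont θ₀).eventually_lt_const (pos_iff_ne_zero.2 hδ), ?_⟩
  have hlim := ENNReal.tendsto_nhds_zero.1
    (tendsto_sampleLaw_wasserstein_of_finite_support hp0 R hS he) (η / 2) (by simp [pos_iff_ne_zero, hη])
  filter_upwards [hlim, eventually_ne_atTop 0] with n hn hn0 θ hθ
  have hW : wasserstein p (P θ : Measure (E d)) R < δ :=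
    calc _ ≤ wasserstein p (P θ : Measure (E d)) (P θ₀) + wasserstein p (P θ₀ : Measure (E d)) R :=
          wasserstein_triangle hp _
      _ < δ / 2 + δ / 2 := ENNReal.add_lt_add hθ hR
      _ = δ := ENNReal.add_halves δ
  calc sampleLaw (P θ) n {x | ε < wasserstein p (empirical x) (P θ)}
      ≤ sampleLaw (P θ) n {x | e + e + δ < wasserstein p (empirical x) (P θ)} := by
        refine measure_mono fun x (hx : ε < _) => Set.mem_ofPred.2 (lt_of_le_of_lt ?_ hx)
        calc e + e + δ ≤ e + e + e := by gcongr
          _ = ε := ENNReal.add_thirds ε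
    _ ≤ (δ / e) ^ p + sampleLaw R n {y | e < wasserstein p (empirical y) R} :=
        sampleLaw_wasserstein_le hp (P θ) R hn0 he he' hW
    _ ≤ η / 2 + η / 2 := add_le_add hδm hn
    _ = η := ENNReal.add_halves η

/-- Uniform law of large numbers in Wasserstein distance over a compact set of parameters. -/
lemma tendsto_iSup_sampleLaw_wasserstein [TopologicalSpace Θ] (hp : 1 ≤ p)
    {P : Θ → ProbabilityMeasure (E d)}
    (hmom : ∀ θ, HasFiniteMoment p (P θ : Measure (E d))) (hcont : WassersteinContinuous p P)
    {K : Set Θ} (hK : IsCompact K) {ε : ℝ≥0∞} (hε : ε ≠ 0) (hε' : ε ≠ ∞) :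
    Tendsto (fun n => ⨆ θ ∈ K, sampleLaw (P θ) n {x | ε < wasserstein p (empirical x) (P θ)})
      atTop (𝓝 0) := by
  refine ENNReal.tendsto_nhds_zero.2 fun η hη => ?_
  have h : ∀ᶠ n in atTop, ∀ θ ∈ K,
      sampleLaw (P θ) n {x | ε < wasserstein p (empirical x) (P θ)} ≤ η := by
    refine hK.induction_on (p := fun S => ∀ᶠ n in atTop, ∀ θ ∈ S,
      sampleLaw (P θ) n {x | ε < wasserstein p (empirical x) (P θ)} ≤ η) ?_ ?_ ?_ ?_
    · simp
    · exact fun s t hst ht => ht.mono fun n hn θ hθ => hn θ (hst hθ)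
    · intro s t hs ht
      filter_upwards [hs, ht] with n hn hn' θ hθ
      exact hθ.elim (hn θ) (hn' θ)
    · intro θ₀ _
      obtain ⟨U, hU, h⟩ :=
        exists_nhds_sampleLaw_wasserstein_le hp hmom hcont θ₀ hε hε' hη.ne'
      exact ⟨U, mem_nhdsWithin_of_mem_nhds hU, h⟩
  exact h.mono fun n hn => iSup₂_le hn

/-- Uniform continuity through a Lebesgue number. Only `θ` lies in `K`; `θ'` is free because the
estimator may leave `K`. -/
lemma exists_forall_dist_le_wasserstein_le [PseudoMetricSpace Θ] (hp : 1 ≤ p)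
    {P : Θ → ProbabilityMeasure (E d)} (hcont : WassersteinContinuous p P)
    {K : Set Θ} (hK : IsCompact K) {ε : ℝ≥0∞} (hε : ε ≠ 0) :
    ∃ δ : ℝ, 0 < δ ∧ ∀ θ ∈ K, ∀ θ', dist θ' θ ≤ δ →
      wasserstein p (P θ : Measure (E d)) (P θ') ≤ ε := by
  set c : Θ → Set Θ := fun θ₀ => interior {θ | wasserstein p (P θ : Measure (E d)) (P θ₀) < ε / 2}
  have hc : ∀ θ₀, θ₀ ∈ c θ₀ := fun θ₀ => mem_interior_iff_mem_nhds.2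
    ((hcont θ₀).eventually_lt_const (by simp [pos_iff_ne_zero, hε]))
  obtain ⟨δ, hδ, h⟩ := lebesgue_number_lemma_of_metric hK (c := c) (fun _ => isOpen_interior)
    fun θ _ => Set.mem_iUnion.2 ⟨θ, hc θ⟩
  refine ⟨δ / 2, by positivity, fun θ hθ θ' hd => ?_⟩
  obtain ⟨θ₀, hθ₀⟩ := h θ hθ
  have hsub : c θ₀ ⊆ {θ | wasserstein p (P θ : Measure (E d)) (P θ₀) < ε / 2} := interior_subset
  have hd' : dist θ' θ < δ := by linarith
  have h1 : wasserstein p (P θ : Measure (E d)) (P θ₀) < ε / 2 :=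
    hsub (hθ₀ (Metric.mem_ball_self hδ))
  have h2 : wasserstein p (P θ' : Measure (E d)) (P θ₀) < ε / 2 :=
    hsub (hθ₀ (Metric.mem_ball.2 hd'))
  calc _ ≤ wasserstein p (P θ : Measure (E d)) (P θ₀) + wasserstein p (P θ₀ : Measure (E d)) (P θ') :=
        wasserstein_triangle hp _
    _ ≤ ε / 2 + ε / 2 := by
        rw [wasserstein_comm p (P θ₀ : Measure (E d))]; exact add_le_add h1.le h2.le
    _ = ε := ENNReal.add_halves ε

variable {P : Θ → ProbabilityMeasure (E d)} {est : (n : ℕ) → (Fin n → E d) → Θ}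

lemma testStat_le_of_wasserstein_le (hp : 0 < p) {n : ℕ} {x : Fin n → E d} {ε : ℝ} (hε : 0 ≤ ε)
    (h : wasserstein p (empirical x) (P (est n x)) ≤ ENNReal.ofReal (ε ^ (1 / p))) :
    testStat p P est n x ≤ ε := by
  have hr : 0 ≤ ε ^ (1 / p) := by positivity
  calc testStat p P est n x ≤ (ε ^ (1 / p)) ^ p :=
        Real.rpow_le_rpow ENNReal.toReal_nonneg
          (ENNReal.toReal_le_of_le_ofReal hr h) hp.le
    _ = ε := by rw [← Real.rpow_mul hε, one_div_mul_cancel hp.ne', Real.rpow_one]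

/-- The statistic tends to zero in probability, uniformly on compact sets of parameters. -/
lemma tendsto_iSup_sampleLaw_testStat [MetricSpace Θ] (hp : 1 ≤ p)
    (hmom : ∀ θ, HasFiniteMoment p (P θ : Measure (E d))) (hcont : WassersteinContinuous p P)
    (hcons : LocUnifConsistent P est) {ε : ℝ} (hε : 0 < ε) {K : Set Θ} (hK : IsCompact K) :
    Tendsto (fun n => ⨆ θ ∈ K, sampleLaw (P θ) n {x | ε < testStat p P est n x})
      atTop (𝓝 0) := by
  have hp0 : 0 < p := by linarith
  set e : ℝ≥0∞ := ENNReal.ofReal (ε ^ (1 / p)) / 2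
  have he : e ≠ 0 := by
    simp only [e, ne_eq, ENNReal.div_eq_zero_iff, ENNReal.ofReal_eq_zero, not_or, not_le]
    exact ⟨by positivity, by simp⟩
  have he' : e ≠ ∞ := ENNReal.div_ne_top ENNReal.ofReal_ne_top (by simp)
  obtain ⟨δ, hδ, hδK⟩ := exists_forall_dist_le_wasserstein_le hp hcont hK he
  have hlim := (tendsto_iSup_sampleLaw_wasserstein hp hmom hcont hK he he').add
    (hcons δ hδ K hK)
  rw [add_zero] at hlim
  refine tendsto_of_tendsto_of_tendsto_of_le_of_le' tendsto_const_nhds hlim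
    (Eventually.of_forall fun n => zero_le) ((eventually_ne_atTop 0).mono fun n hn => ?_)
  refine iSup₂_le fun θ hθ => le_trans ?_ (add_le_add
    (le_iSup₂ (f := fun θ (_ : θ ∈ K) => sampleLaw (P θ) n
      {x | e < wasserstein p (empirical x) (P θ)}) θ hθ)
    (le_iSup₂ (f := fun θ (_ : θ ∈ K) => sampleLaw (P θ) n {x | δ < dist (est n x) θ}) θ hθ))
  refine le_trans (measure_mono fun x hx => ?_) (measure_union_le _ _)
  by_contra hcon
  simp only [Set.mem_union, Set.mem_ofPred_eq, not_or, not_lt] at hcon hx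
  have := isProbabilityMeasure_empirical hn x
  refine absurd hx (not_lt.2 (testStat_le_of_wasserstein_le hp0 hε.le ?_))
  calc _ ≤ wasserstein p (empirical x) (P θ) + wasserstein p (P θ : Measure (E d)) (P (est n x)) :=
        wasserstein_triangle hp _
    _ ≤ e + e := add_le_add hcon.1 (hδK θ hθ _ hcon.2)
    _ = _ := ENNReal.add_halves _

lemma eventually_forall_sampleLaw_testStat_le [MetricSpace Θ] (hp : 1 ≤ p)
    (hmom : ∀ θ, HasFiniteMoment p (P θ : Measure (E d))) (hcont : WassersteinContinuous p P)
    (hcons : LocUnifConsistent P est) {ε : ℝ} (hε : 0 < ε) {K : Set Θ} (hK : IsCompact K)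
    {α : ℝ} (hα : 0 < α) :
    ∀ᶠ n in atTop, ∀ θ ∈ K,
      sampleLaw (P θ) n {x | ε < testStat p P est n x} ≤ ENNReal.ofReal α :=
  (ENNReal.tendsto_nhds_zero.1 (tendsto_iSup_sampleLaw_testStat hp hmom hcont hcons hε hK) _
    (ENNReal.ofReal_pos.2 hα)).mono fun _ hn _ hθ => iSup₂_le_iff.1 hn _ hθ

lemma one_sub_le_nullCDF {n : ℕ} {θ : Θ} {α ε : ℝ} (hα : 0 ≤ α)
    (h : sampleLaw (P θ) n {x | ε < testStat p P est n x} ≤ ENNReal.ofReal α) :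
    1 - α ≤ nullCDF p P est n θ ε := by
  have h1 : (sampleLaw (P θ) n).real {x | ε < testStat p P est n x} ≤ α :=
    ENNReal.toReal_le_of_le_ofReal hα h
  have h2 : (sampleLaw (P θ) n).real Set.univ ≤ nullCDF p P est n θ ε
      + (sampleLaw (P θ) n).real {x | ε < testStat p P est n x} := by
    refine le_trans (measureReal_mono fun x _ => ?_) (measureReal_union_le _ _)
    exact le_or_gt (testStat p P est n x) ε
  rw [probReal_univ] at h2
  linarith

lemma nullCDF_mono {n : ℕ} {θ : Θ} {s t : ℝ} (h : s ≤ t) :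
    nullCDF p P est n θ s ≤ nullCDF p P est n θ t :=
  measureReal_mono fun _ hx => le_trans hx h

lemma critValue_le {n : ℕ} {θ : Θ} {α ε : ℝ} (hα : 0 ≤ α) (hε : 0 ≤ ε)
    (h : sampleLaw (P θ) n {x | ε < testStat p P est n x} ≤ ENNReal.ofReal α) :
    critValue p P est α n θ ≤ ε :=
  csInf_le ⟨0, fun _ ht => ht.1⟩ ⟨hε, one_sub_le_nullCDF hα h⟩

/-- Distinct probability measures are separated by a bounded Lipschitz function. -/
lemma exists_lipschitz_integral_ne {Q R : ProbabilityMeasure (E d)} (h : Q ≠ R) :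
    ∃ (f : E d → ℝ) (C : ℝ) (L : NNReal), (∀ x, |f x| ≤ C) ∧ LipschitzWith L f ∧
      ∫ x, f x ∂(Q : Measure (E d)) ≠ ∫ x, f x ∂(R : Measure (E d)) := by
  by_contra! hcon
  -- If all these integrals agreed, the constant sequence `Q` would converge weakly to both `Q` and
  -- `R`.
  refine h (tendsto_nhds_unique (f := fun _ : ℕ => Q) (l := atTop) tendsto_const_nhds ?_)
  refine tendsto_iff_forall_lipschitz_integral_tendsto.2 fun f ⟨C, hC⟩ ⟨L, hL⟩ => ?_
  rw [hcon f (C + |f 0|) L (fun x => ?_) hL]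
  · exact tendsto_const_nhds
  · have h1 := hC x 0
    rw [Real.dist_eq] at h1
    have h2 := abs_sub_abs_le_abs_sub (f x) (f 0)
    linarith

/-- A law outside the model stays away from the compact parts of the model. -/
lemma exists_tendsto_sampleLaw_wasserstein_lt [TopologicalSpace Θ] (hp : 1 ≤ p)
    (hcont : WassersteinContinuous p P) {Q : ProbabilityMeasure (E d)} (hQ : Q ∉ Set.range P)
    {K : Set Θ} (hK : IsCompact K) :
    ∃ δ : ℝ, 0 < δ ∧ Tendsto (fun n => sampleLaw Q n
      {x | ∃ θ ∈ K, wasserstein p (empirical x) (P θ) < ENNReal.ofReal δ}) atTop (𝓝 0) := by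
  refine hK.induction_on (p := fun S => ∃ δ : ℝ, 0 < δ ∧ Tendsto (fun n => sampleLaw Q n
    {x | ∃ θ ∈ S, wasserstein p (empirical x) (P θ) < ENNReal.ofReal δ}) atTop (𝓝 0))
    ?_ ?_ ?_ ?_
  · exact ⟨1, one_pos, by simp⟩
  · rintro s t hst ⟨δ, hδ, h⟩
    refine ⟨δ, hδ, tendsto_of_tendsto_of_tendsto_of_le_of_le tendsto_const_nhds h
      (fun _ => zero_le) fun n => measure_mono ?_⟩
    rintro x ⟨θ, hθ, hx⟩
    exact ⟨θ, hst hθ, hx⟩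
  · rintro s t ⟨δ, hδ, h⟩ ⟨δ', hδ', h'⟩
    have hlim := h.add h'
    rw [add_zero] at hlim
    refine ⟨min δ δ', lt_min hδ hδ', tendsto_of_tendsto_of_tendsto_of_le_of_le
      tendsto_const_nhds hlim (fun _ => zero_le) fun n =>
        le_trans (measure_mono ?_) (measure_union_le _ _)⟩
    rintro x ⟨θ, hθ | hθ, hx⟩
    · exact Or.inl ⟨θ, hθ, hx.trans_le (ENNReal.ofReal_le_ofReal (min_le_left _ _))⟩
    · exact Or.inr ⟨θ, hθ, hx.trans_le (ENNReal.ofReal_le_ofReal (min_le_right _ _))⟩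
  · intro θ₀ _
    obtain ⟨f, C, L, hC, hL, hne⟩ :=
      exists_lipschitz_integral_ne (Q := Q) (R := P θ₀) fun h => hQ ⟨θ₀, h.symm⟩
    have hint : ∀ μ : Measure (E d), [IsProbabilityMeasure μ] → Integrable f μ := fun μ _ =>
      Integrable.of_bound hL.continuous.aestronglyMeasurable C (Eventually.of_forall hC)
    -- The gap is `3 * g`. Each of the two Wasserstein steps, from the empirical law to `P θ` and on
    -- to `P θ₀`, uses at most `L * δ ≤ g`; the last `g` is a deviation of the empirical mean from
    -- that of `Q`. The `L + 1` in `δ` covers `L = 0`.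
    set g : ℝ := |∫ x, f x ∂(Q : Measure (E d)) - ∫ x, f x ∂(P θ₀ : Measure (E d))| / 3
    have hg : 0 < g := by
      have := abs_pos.2 (sub_ne_zero.2 hne)
      positivity
    set δ : ℝ := g / (L + 1)
    have hδ : 0 < δ := by positivity
    have hLδ : L * δ ≤ g := by
      have h1 : (L + 1 : ℝ) * δ = g := mul_div_cancel₀ _ (by positivity)
      linarith
    refine ⟨{θ | wasserstein p (P θ : Measure (E d)) (P θ₀) < ENNReal.ofReal δ},
      mem_nhdsWithin_of_mem_nhds ((hcont θ₀).eventually_lt_const (ENNReal.ofReal_pos.2 hδ)),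
      δ, hδ, ?_⟩
    refine tendsto_of_tendsto_of_tendsto_of_le_of_le' tendsto_const_nhds
      (tendsto_sampleLaw_integral_empirical Q hL.continuous.measurable hC hg)
      (Eventually.of_forall fun n => zero_le)
      ((eventually_ne_atTop 0).mono fun n hn => measure_mono ?_)
    rintro x ⟨θ, hθ, hx⟩
    have := isProbabilityMeasure_empirical hn x
    have h1 := abs_integral_sub_le_of_wasserstein_lt hp hL (hint _) (hint _) hx
    have h2 := abs_integral_sub_le_of_wasserstein_lt hp hL (hint _) (hint _) hθ
    have h3 : |∫ x, f x ∂(Q : Measure (E d)) - ∫ x, f x ∂(P θ₀ : Measure (E d))| = 3 * g := by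
      simp only [g]; ring
    change g ≤ _
    rw [abs_sub_comm]
    have h4 := abs_sub_le (∫ x, f x ∂(Q : Measure (E d))) (∫ y, f y ∂(empirical x))
      (∫ x, f x ∂(P θ₀ : Measure (E d)))
    have h5 := abs_sub_le (∫ y, f y ∂(empirical x)) (∫ x, f x ∂(P θ : Measure (E d)))
      (∫ x, f x ∂(P θ₀ : Measure (E d)))
    linarith

lemma tendsto_measure_one_of_diff_subset {Ω : ℕ → Type*} [∀ n, MeasurableSpace (Ω n)]
    {μ : ∀ n, Measure (Ω n)} [∀ n, IsProbabilityMeasure (μ n)] {A B D : ∀ n, Set (Ω n)}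
    (hA : Tendsto (fun n => μ n (A n)) atTop (𝓝 1)) (hB : Tendsto (fun n => μ n (B n)) atTop (𝓝 0))
    (h : ∀ᶠ n in atTop, A n \ B n ⊆ D n) : Tendsto (fun n => μ n (D n)) atTop (𝓝 1) := by
  have hlim := ENNReal.Tendsto.sub hA hB (Or.inl ENNReal.one_ne_top)
  rw [tsub_zero] at hlim
  exact tendsto_of_tendsto_of_tendsto_of_le_of_le' hlim tendsto_const_nhds
    (h.mono fun n hn => le_measure_sdiff.trans (measure_mono hn))
    (Eventually.of_forall fun n => prob_le_one)

/-- If the statistic reaches a level that is rarely exceeded at the estimated parameter, then the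
test rejects. -/
lemma bootTest_eq_one {n : ℕ} {x : Fin n → E d} {α ε : ℝ} (hα : 0 ≤ α)
    (hT : ε ≤ testStat p P est n x)
    (h : sampleLaw (P (est n x)) n {y | ε < testStat p P est n y} ≤ ENNReal.ofReal α) :
    bootTest p P est α n x = 1 := by
  rw [bootTest, if_pos]
  have h1 := one_sub_le_nullCDF hα h
  have h2 := nullCDF_mono (p := p) (P := P) (est := est) (n := n) (θ := est n x) hT
  linarith

lemma le_testStat_of_le_wasserstein (hp : 1 ≤ p)
    (hmom : ∀ θ, HasFiniteMoment p (P θ : Measure (E d))) {n : ℕ} (hn : n ≠ 0) {x : Fin n → E d}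
    {δ : ℝ} (hδ : 0 ≤ δ) (h : ENNReal.ofReal δ ≤ wasserstein p (empirical x) (P (est n x))) :
    δ ^ p ≤ testStat p P est n x := by
  have := isProbabilityMeasure_empirical hn x
  have hfin := wasserstein_ne_top hp (hasFiniteMoment_empirical (by linarith) hn x)
    (hmom (est n x))
  exact Real.rpow_le_rpow hδ ((ENNReal.ofReal_le_iff_le_toReal hfin).1 h) (by linarith)

end Model

end WassersteinGoF

theorem mainTheorem3 {d : ℕ} {p : ℝ} (hp : 1 ≤ p)
    {Θ : Type*} [MetricSpace Θ] [MeasurableSpace Θ] [BorelSpace Θ]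
    (P : Θ → ProbabilityMeasure (WassersteinGoF.E d))
    (hmom : ∀ θ, WassersteinGoF.HasFiniteMoment p (P θ : Measure (WassersteinGoF.E d)))
    (hinj : Function.Injective P)
    (hcont : WassersteinGoF.WassersteinContinuous p P)
    (est : (n : ℕ) → (Fin n → WassersteinGoF.E d) → Θ)
    (hmeas : ∀ n, Measurable (est n))
    (hcons : WassersteinGoF.LocUnifConsistent P est) :
    -- (i) the statistic tends to zero in probability, uniformly on compact sets
    (∀ ε : ℝ, 0 < ε → ∀ K : Set Θ, IsCompact K →
      Tendsto (fun n => ⨆ θ ∈ K, WassersteinGoF.sampleLaw (P θ) n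
        {x | ε < WassersteinGoF.testStat p P est n x}) atTop (𝓝 0)) ∧
    -- (ii) the (nonnegative) critical values tend to zero, uniformly on compact sets
    (∀ α : ℝ, 0 < α → ∀ K : Set Θ, IsCompact K →
      Tendsto (fun n => ⨆ θ ∈ K, ENNReal.ofReal (WassersteinGoF.critValue p P est α n θ))
        atTop (𝓝 0)) ∧
    -- (iii) consistency of the test, for its two equivalent rejection rules
    (∀ α : ℝ, 0 < α → ∀ Q : ProbabilityMeasure (WassersteinGoF.E d), Q ∉ Set.range P →
      (∃ K : Set Θ, IsCompact K ∧
        Tendsto (fun n => WassersteinGoF.sampleLaw Q n {x | est n x ∈ K}) atTop (𝓝 1)) →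
      Tendsto (fun n => WassersteinGoF.sampleLaw Q n
        {x | WassersteinGoF.bootTest p P est α n x = 1}) atTop (𝓝 1) ∧
      Tendsto (fun n => WassersteinGoF.sampleLaw Q n
        {x | WassersteinGoF.critValue p P est α n (est n x)
          ≤ WassersteinGoF.testStat p P est n x}) atTop (𝓝 1)) := by
  open WassersteinGoF in
  refine ⟨fun ε hε K hK => tendsto_iSup_sampleLaw_testStat hp hmom hcont hcons hε hK,
    fun α hα K hK => ?_, fun α hα Q hQ ⟨K, hK, hestK⟩ => ?_⟩
  · refine ENNReal.tendsto_nhds_zero.2 fun η hη => ?_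
    obtain ⟨ε, hε, hεη⟩ := ENNReal.lt_iff_exists_nnreal_btwn.1 hη
    filter_upwards [eventually_forall_sampleLaw_testStat_le hp hmom hcont hcons
      (ε := ε) (by exact_mod_cast hε) hK hα] with n hn
    refine iSup₂_le fun θ hθ => le_trans ?_ hεη.le
    rw [← ENNReal.ofReal_coe_nnreal]
    exact ENNReal.ofReal_le_ofReal (critValue_le hα.le ε.coe_nonneg (hn θ hθ))
  · obtain ⟨δ, hδ, hfar⟩ := exists_tendsto_sampleLaw_wasserstein_lt hp hcont hQ hK
    have hτ : 0 < δ ^ p := by positivity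
    -- The level `δ ^ p` is the one `T_n` reaches under `Q`. The tail bound holds for all `θ ∈ K` at
    -- once, so it may be used at `est n x`.
    have hev := eventually_forall_sampleLaw_testStat_le hp hmom hcont hcons hτ hK hα
    have hT : ∀ n ≠ 0, ∀ x : Fin n → E d, est n x ∈ K →
        (¬ ∃ θ ∈ K, wasserstein p (empirical x) (P θ) < ENNReal.ofReal δ) →
        δ ^ p ≤ testStat p P est n x := fun n hn x hx hx' =>
      le_testStat_of_le_wasserstein hp hmom hn hδ.le
        (not_lt.1 fun hlt => hx' ⟨est n x, hx, hlt⟩)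
    constructor
    · refine tendsto_measure_one_of_diff_subset hestK hfar ?_
      filter_upwards [hev, eventually_ne_atTop 0] with n hn hn0 x hx
      exact bootTest_eq_one hα.le (hT n hn0 x hx.1 hx.2) (hn _ hx.1)
    · refine tendsto_measure_one_of_diff_subset hestK hfar ?_
      filter_upwards [hev, eventually_ne_atTop 0] with n hn hn0 x hx
      exact (critValue_le hα.le hτ.le (hn _ hx.1)).trans (hT n hn0 x hx.1 hx.2)
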